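/- For $n\ge 1$ let $\left(\frac{-3}{n}\right)$ denote the Kronecker symbol (so it equals $1$, $-1$, $0$ according as $n\equiv 1,2,0 \pmod 3$), and let $L_{-3}(s)=\sum_{n\ge 1}\left(\frac{-3}{n}\right)n^{-s}$. Then the series below and the series defining $L_{-3}(2)$ both converge absolutely, and $$L_{-3}(2)=\frac{2}{15}\sum_{k=1}^{\infty}\frac{48^k}{k(2k-1)\binom{4k}{2k}\binom{2k}{k}}.$$ -/

import Mathlib

/-- The Kronecker symbol `(D / n)` for an integer `D` and a natural number `n`: completely
multiplicative in `n`, equal to the Legendre symbol at odd primes, and at the prime `2` equal to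
`0` for even `D`, `1` for `D ≡ ±1 (mod 8)`, `-1` for `D ≡ ±3 (mod 8)`; this last function is
`ZMod.χ₈`. (Mathlib's `jacobiSym` gives another value at even `n`, so it is only applied to the odd
part of `n` here.) By convention `(D / 0)` is `1` if `D = ±1` and `0` otherwise. -/
def kroneckerSym (D : ℤ) (n : ℕ) : ℤ :=
  if n = 0 then (if D = 1 ∨ D = -1 then 1 else 0)
  else ZMod.χ₈ (D : ZMod 8) ^ n.factorization 2 * jacobiSym D (n / 2 ^ n.factorization 2)

/-- The Dirichlet series `L_D(s) = ∑_{n ≥ 1} (D / n) n ^ (-s)`. -/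
noncomputable def kroneckerL (D : ℤ) (s : ℂ) : ℂ :=
  LSeries (fun n : ℕ => (kroneckerSym D n : ℂ)) s

/-!
The series is evaluated by a Wilf–Zeilberger pair with a continuous parameter. For real `x ≥ 0` put
`F(x, k) = x * wzTerm x k`, where `wzTerm x` is a hypergeometric sequence of asymptotic ratio `3 / 4`
and `wzTerm 0 k` is twice the summand of index `k + 1` of the series (`wzTerm_zero_eq`). There is a
rational multiple `wzMate` of `wzTerm` with
`F(x + 1, k) - F(x, k) = wzMate x k - wzMate x (k + 1)` (`wz_pair`), so that the sum
`wzSum x = ∑ k, F(x, k)` satisfies `wzSum (x + 1) = wzSum x + wzStep x` with the rational function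
`wzStep x = 8 / ((6 x + 1) (6 x + 5)) = 2 / (6 x + 1) - 2 / (6 x + 5)` (`wzSum_add_one`).

Since `F(0, k) = 0`, the desired sum is a derivative at `0`:
`∑ k, wzTerm 0 k = lim_{x → 0+} wzSum x / x`. To compute it, the functional equation is iterated up to
infinity. The function `(6 x + 1) * wzSum x` is monotone (`wzSum_mul_mono`), hence `wzSum (x + N)` has
as `N → ∞` the same limit for all `x ∈ [0, 1]` (`tendsto_wzSum_add_natCast`), and therefore
`wzSum x = ∑ n, (wzStep n - wzStep (x + n))`. Dividing by `x` and letting `x → 0+`, with dominated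
convergence on both sides, gives
`∑ k, wzTerm 0 k = 12 * ∑ n, (1 / (6 n + 1) ^ 2 - 1 / (6 n + 5) ^ 2)` (`tsum_wzTerm_zero`).
The right side is `12` times the part of `L_{-3}(2)` over odd `n`, that is
`12 * (5 / 4) * L_{-3}(2)`, because `(-3 / 2) = -1` (`tsum_chi_div_sq`).
-/

open Filter Topology

/-! ### The Wilf–Zeilberger pair -/

/-- The hypergeometric sequence given in closed form by
`3 ^ (k + 1) (k + 1)! / (1 / 2)_{k + 1} * (x + 1)_k / ∏_{j ≤ k + 1} (3 x + k + 1 / 2 + j)`;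
it is defined by its first term and its ratio of consecutive terms. -/
noncomputable def wzTerm (x : ℝ) : ℕ → ℝ
  | 0 => 24 / ((6 * x + 1) * (6 * x + 3))
  | k + 1 => wzTerm x k * (12 * (k + 2) * (x + k + 1) * (6 * x + 2 * k + 1) /
      ((2 * k + 3) * (6 * x + 4 * k + 5) * (6 * x + 4 * k + 7)))

/-- The companion of `(x, k) ↦ x * wzTerm x k` in the Wilf–Zeilberger equation `wz_pair`. -/
noncomputable def wzMate (x : ℝ) (k : ℕ) : ℝ :=
  (2 * k + 1) * (2 * x + k + 1) / (6 * x + 4 * k + 5) * wzTerm x k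

/-- The boundary term `wzMate x 0` in closed form, see `wzMate_zero`. -/
noncomputable def wzStep (x : ℝ) : ℝ := 8 / ((6 * x + 1) * (6 * x + 5))

theorem wzTerm_pos {x : ℝ} (hx : 0 ≤ x) (k : ℕ) : 0 < wzTerm x k := by
  induction k with
  | zero => rw [wzTerm]; positivity
  | succ k ih => rw [wzTerm]; positivity

theorem wzTerm_add_one {x : ℝ} (hx : 0 ≤ x) (k : ℕ) :
    wzTerm (x + 1) k = wzTerm x k *
      ((x + k + 1) * (6 * x + 2 * k + 1) * (6 * x + 2 * k + 3) * (6 * x + 2 * k + 5) /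
        ((x + 1) * (6 * x + 4 * k + 5) * (6 * x + 4 * k + 7) * (6 * x + 4 * k + 9))) := by
  induction k with
  | zero =>
    simp only [wzTerm, Nat.cast_zero]
    rw [show 6 * (x + 1) + 1 = 6 * x + 7 by ring, show 6 * (x + 1) + 3 = 6 * x + 9 by ring]
    field_simp
    ring
  | succ k ih =>
    simp only [wzTerm, ih, Nat.cast_add, Nat.cast_one]
    rw [show x + 1 + k + 1 = x + k + 2 by ring,
      show 6 * (x + 1) + 2 * k + 1 = 6 * x + 2 * k + 7 by ring,
      show 6 * (x + 1) + 4 * k + 5 = 6 * x + 4 * k + 11 by ring,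
      show 6 * (x + 1) + 4 * k + 7 = 6 * x + 4 * k + 13 by ring,
      show x + (k + 1) + 1 = x + k + 2 by ring,
      show 6 * x + 2 * (k + 1) + 1 = 6 * x + 2 * k + 3 by ring,
      show 6 * x + 2 * (k + 1) + 3 = 6 * x + 2 * k + 5 by ring,
      show 6 * x + 2 * (k + 1) + 5 = 6 * x + 2 * k + 7 by ring,
      show 6 * x + 4 * (k + 1) + 5 = 6 * x + 4 * k + 9 by ring,
      show 6 * x + 4 * (k + 1) + 7 = 6 * x + 4 * k + 11 by ring,
      show 6 * x + 4 * (k + 1) + 9 = 6 * x + 4 * k + 13 by ring]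
    field_simp

theorem wz_pair {x : ℝ} (hx : 0 ≤ x) (k : ℕ) :
    (x + 1) * wzTerm (x + 1) k - x * wzTerm x k = wzMate x k - wzMate x (k + 1) := by
  rw [wzTerm_add_one hx]
  simp only [wzMate, wzTerm, Nat.cast_add, Nat.cast_one]
  rw [show 6 * x + 4 * (k + 1) + 5 = 6 * x + 4 * k + 9 by ring,
    show 2 * x + (k + 1) + 1 = 2 * (x + k / 2 + 1) by ring]
  field_simp
  ring

theorem wzMate_zero {x : ℝ} (hx : 0 ≤ x) : wzMate x 0 = wzStep x := by
  simp only [wzMate, wzTerm, wzStep, Nat.cast_zero]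
  field_simp
  ring

/-! ### The sum over `k` and its functional equation -/

/-- The factor `k + 1` is there because `wzMate x k` is of the order of `k * wzTerm x k`. -/
theorem summable_add_one_mul_wzTerm {x : ℝ} (hx : 0 ≤ x) :
    Summable fun k : ℕ => ((k : ℝ) + 1) * wzTerm x k := by
  have lim (a b c d : ℝ) (hd : d ≠ 0) :
      Tendsto (fun k : ℕ => (a + c * (k : ℝ)) / (b + d * k)) atTop (𝓝 (c / d)) :=
    tendsto_add_mul_div_add_mul_atTop_nhds a b c hd
  refine summable_of_ratio_test_tendsto_lt_one (l := 3 / 4) (by norm_num)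
    (Eventually.of_forall fun k => (mul_pos (by positivity) (wzTerm_pos hx k)).ne') ?_
  have h := (((lim 2 1 1 1 one_ne_zero).mul (lim 24 3 12 2 two_ne_zero)).mul
    (lim (x + 1) (6 * x + 5) 1 4 four_ne_zero)).mul
    (lim (6 * x + 1) (6 * x + 7) 2 4 four_ne_zero)
  -- the four limits multiply up to the asymptotic ratio `3 / 4`
  rw [show (1 / 1 * (12 / 2) * (1 / 4) * (2 / 4) : ℝ) = 3 / 4 by norm_num] at h
  refine h.congr fun k => ?_
  have h1 := wzTerm_pos hx k
  rw [Real.norm_of_nonneg (mul_pos (by positivity) (wzTerm_pos hx (k + 1))).le,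
    Real.norm_of_nonneg (mul_pos (by positivity) h1).le, wzTerm]
  push_cast
  rw [show (6 * x + 5 + 4 * (k:ℝ)) = 6 * x + 4 * k + 5 by ring,
    show (6 * x + 7 + 4 * (k:ℝ)) = 6 * x + 4 * k + 7 by ring]
  field_simp
  ring

theorem summable_wzTerm {x : ℝ} (hx : 0 ≤ x) : Summable (wzTerm x) :=
  (summable_add_one_mul_wzTerm hx).of_nonneg_of_le (fun k => (wzTerm_pos hx k).le) fun k =>
    le_mul_of_one_le_left (wzTerm_pos hx k).le (by simp)

theorem tendsto_wzMate {x : ℝ} (hx : 0 ≤ x) : Tendsto (wzMate x) atTop (𝓝 0) := by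
  have h := ((summable_add_one_mul_wzTerm hx).tendsto_atTop_zero).const_mul (2 * (2 * x + 1))
  rw [mul_zero] at h
  refine squeeze_zero (fun k => ?_) (fun k => ?_) h
  · have := wzTerm_pos hx k
    rw [wzMate]; positivity
  · rw [wzMate, ← mul_assoc]
    refine mul_le_mul_of_nonneg_right ?_ (wzTerm_pos hx k).le
    have hk : (0:ℝ) ≤ k := k.cast_nonneg
    rw [div_le_iff₀ (by positivity)]
    nlinarith [mul_nonneg hx hk, mul_nonneg hk hk, mul_nonneg (mul_nonneg hx hk) hk,
      mul_nonneg (mul_nonneg hx hx) hk, mul_nonneg hx hx]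

/-- The sum over `k` of the first member `x * wzTerm x k` of the Wilf–Zeilberger pair. The factor `x`
makes it vanish at `0`. -/
noncomputable def wzSum (x : ℝ) : ℝ := x * ∑' k, wzTerm x k

theorem wzSum_add_one {x : ℝ} (hx : 0 ≤ x) : wzSum (x + 1) = wzSum x + wzStep x := by
  have hs1 := (summable_wzTerm (by positivity : 0 ≤ x + 1)).hasSum.mul_left (x + 1)
  have hs0 := (summable_wzTerm hx).hasSum.mul_left x
  have h := (hs1.sub hs0).tendsto_sum_nat
  have h2 : Tendsto (fun n => wzMate x 0 - wzMate x n) atTop (𝓝 (wzMate x 0 - 0)) :=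
    (tendsto_wzMate hx).const_sub _
  have := tendsto_nhds_unique h (h2.congr fun n => by
    simp only [wz_pair hx, Finset.sum_range_sub'])
  rw [wzMate_zero hx] at this
  simp only [wzSum]
  linarith

theorem wzSum_add_natCast {x : ℝ} (hx : 0 ≤ x) (N : ℕ) :
    wzSum (x + N) = wzSum x + ∑ n ∈ Finset.range N, wzStep (x + n) := by
  induction N with
  | zero => simp
  | succ N ih =>
    rw [Finset.sum_range_succ, Nat.cast_succ, ← add_assoc, wzSum_add_one (by positivity), ih,
      add_assoc]

/-! ### Behaviour of the sum at infinity -/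

/-- For `x ≤ y` the quotient `wzTerm y k / wzTerm x k` is smallest at `k = 0`, because the ratio of
consecutive terms of `wzTerm x` increases with `x`. -/
theorem wzTerm_ratio_mono {x y : ℝ} (hx : 0 ≤ x) (hxy : x ≤ y) (k : ℕ) :
    (6 * x + 1) * (6 * x + 3) * wzTerm x k ≤ (6 * y + 1) * (6 * y + 3) * wzTerm y k := by
  have hy := hx.trans hxy
  induction k with
  | zero =>
    simp only [wzTerm]
    rw [mul_div_cancel₀ _ (by positivity), mul_div_cancel₀ _ (by positivity)]
  | succ k ih =>
    simp only [wzTerm, ← mul_assoc]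
    have := wzTerm_pos hx k
    refine mul_le_mul ih ?_ (by positivity) (by have := wzTerm_pos hy k; positivity)
    have hk : (0:ℝ) ≤ k := k.cast_nonneg
    have key : (x + k + 1) * (6 * x + 2 * k + 1) / ((6 * x + 4 * k + 5) * (6 * x + 4 * k + 7)) ≤
        (y + k + 1) * (6 * y + 2 * k + 1) / ((6 * y + 4 * k + 5) * (6 * y + 4 * k + 7)) := by
      rw [div_le_div_iff₀ (by positivity) (by positivity), ← sub_nonneg]
      obtain ⟨z, rfl⟩ := exists_add_of_le hxy
      have hz : 0 ≤ z := by linarith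
      -- with `y = x + z` the difference is a polynomial in `x`, `z`, `k` with positive coefficients
      ring_nf
      positivity
    calc _ = 12 * (k + 2) / (2 * k + 3) * ((x + k + 1) * (6 * x + 2 * k + 1) /
          ((6 * x + 4 * k + 5) * (6 * x + 4 * k + 7))) := by field_simp
      _ ≤ 12 * (k + 2) / (2 * k + 3) * ((y + k + 1) * (6 * y + 2 * k + 1) /
          ((6 * y + 4 * k + 5) * (6 * y + 4 * k + 7))) := by gcongr
      _ = _ := by field_simp

/-- Termwise monotonicity fails for `wzSum` itself; the factor `6 x + 1` repairs it at the price of a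
quotient `(6 x + 7) / (6 x + 1)` over unit steps, which tends to `1`. -/
theorem wzSum_mul_mono {x y : ℝ} (hx : 0 ≤ x) (hxy : x ≤ y) :
    (6 * x + 1) * wzSum x ≤ (6 * y + 1) * wzSum y := by
  have hy := hx.trans hxy
  have h : (6 * x + 1) * (6 * x + 3) * ∑' k, wzTerm x k ≤
      (6 * y + 1) * (6 * y + 3) * ∑' k, wzTerm y k := by
    rw [← tsum_mul_left, ← tsum_mul_left]
    exact ((summable_wzTerm hx).mul_left _).tsum_le_tsum (wzTerm_ratio_mono hx hxy)
      ((summable_wzTerm hy).mul_left _)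
  have h0 : 0 ≤ ∑' k, wzTerm x k := tsum_nonneg fun k => (wzTerm_pos hx k).le
  have hq : x / (6 * x + 3) ≤ y / (6 * y + 3) := by
    rw [div_le_div_iff₀ (by positivity) (by positivity)]; nlinarith
  calc (6 * x + 1) * wzSum x
      = x / (6 * x + 3) * ((6 * x + 1) * (6 * x + 3) * ∑' k, wzTerm x k) := by
        rw [wzSum]; field_simp
    _ ≤ y / (6 * y + 3) * ((6 * y + 1) * (6 * y + 3) * ∑' k, wzTerm y k) := by
        refine mul_le_mul hq h (by positivity) (by positivity)
    _ = _ := by rw [wzSum]; field_simp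

theorem summable_inv_add_one_sq : Summable fun n : ℕ => (1 : ℝ) / ((n : ℝ) + 1) ^ 2 := by
  have := (summable_nat_add_iff 1).2 (Real.summable_one_div_nat_pow.2 one_lt_two)
  simpa using this

theorem summable_wzStep {x : ℝ} (hx : 0 ≤ x) : Summable fun n : ℕ => wzStep (x + n) := by
  refine (summable_inv_add_one_sq.mul_left 8).of_nonneg_of_le
    (fun n => by rw [wzStep]; positivity) fun n => ?_
  have hn : (0:ℝ) ≤ n := n.cast_nonneg
  rw [wzStep, mul_one_div]
  gcongr
  nlinarith [mul_nonneg hx hn, mul_nonneg hx hx, mul_nonneg hn hn]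

theorem tendsto_wzSum_natCast :
    Tendsto (fun N : ℕ => wzSum N) atTop (𝓝 (∑' n : ℕ, wzStep n)) := by
  have h := (summable_wzStep le_rfl).hasSum.tendsto_sum_nat
  simp only [zero_add] at h
  refine h.congr fun N => ?_
  have := wzSum_add_natCast le_rfl N
  simp only [zero_add] at this
  rw [this, wzSum, zero_mul, zero_add]

/-- The values of `wzSum` at `x + N` are squeezed between those at `N` and `N + 1`. -/
theorem tendsto_wzSum_add_natCast {x : ℝ} (hx : 0 ≤ x) (hx1 : x ≤ 1) :
    Tendsto (fun N : ℕ => wzSum (x + N)) atTop (𝓝 (∑' n : ℕ, wzStep n)) := by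
  have lim (a b : ℝ) : Tendsto (fun k : ℕ => (a + 6 * (k : ℝ)) / (b + 6 * k)) atTop (𝓝 1) := by
    simpa using tendsto_add_mul_div_add_mul_atTop_nhds a b (6 : ℝ) (d := 6) (by norm_num)
  have hlo := (lim 1 7).mul tendsto_wzSum_natCast
  have hhi := (lim 7 1).mul (tendsto_wzSum_natCast.comp (tendsto_add_atTop_nat 1))
  rw [one_mul] at hlo hhi
  refine tendsto_of_tendsto_of_tendsto_of_le_of_le hlo hhi (fun N => ?_) (fun N => ?_)
  · have hN : (0:ℝ) ≤ N := N.cast_nonneg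
    have h := wzSum_mul_mono hN (by linarith : (N:ℝ) ≤ x + N)
    have h0 : 0 ≤ wzSum (x + N) :=
      mul_nonneg (by positivity) (tsum_nonneg fun k => (wzTerm_pos (by positivity) k).le)
    simp only
    rw [div_mul_eq_mul_div, div_le_iff₀ (by positivity)]
    nlinarith
  · have hN : (0:ℝ) ≤ N := N.cast_nonneg
    have h := wzSum_mul_mono (by positivity : 0 ≤ x + N) (by linarith : x + N ≤ (N:ℝ) + 1)
    have h0 : 0 ≤ wzSum (x + N) :=
      mul_nonneg (by positivity) (tsum_nonneg fun k => (wzTerm_pos (by positivity) k).le)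
    simp only [Function.comp, Nat.cast_add, Nat.cast_one]
    rw [div_mul_eq_mul_div, le_div_iff₀ (by positivity)]
    nlinarith

/-- Comparison of the functional equation iterated from `x` and from `0`: both sides have the same
limit at infinity, and `wzSum 0 = 0`. -/
theorem tsum_wzTerm_eq {x : ℝ} (hx : 0 < x) (hx1 : x ≤ 1) :
    ∑' k, wzTerm x k = ∑' n : ℕ, (wzStep n - wzStep (x + n)) / x := by
  have h1 := tendsto_wzSum_add_natCast hx.le hx1
  have h2 := ((summable_wzStep hx.le).hasSum.tendsto_sum_nat).const_add (wzSum x)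
  have h3 := tendsto_nhds_unique h1 (h2.congr fun N => (wzSum_add_natCast hx.le N).symm)
  have hs0 := summable_wzStep le_rfl
  simp only [zero_add] at hs0
  rw [tsum_div_const, hs0.tsum_sub (summable_wzStep hx.le), h3, add_sub_cancel_right, wzSum,
    mul_div_cancel_left₀ _ hx.ne']

/-! ### The limit at parameter zero -/

theorem continuousAt_wzTerm (k : ℕ) : ContinuousAt (fun x => wzTerm x k) 0 := by
  induction k with
  | zero =>
    simp only [wzTerm]
    refine ContinuousAt.div (by fun_prop) (by fun_prop) (by norm_num)
  | succ k ih =>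
    simp only [wzTerm]
    refine ih.mul (ContinuousAt.div (by fun_prop) (by fun_prop) ?_)
    simp only [mul_zero, zero_add]
    positivity

/-- By `wzTerm_ratio_mono`, the terms at `x ∈ [0, 1]` are dominated by multiples of those at `1`. -/
theorem tendsto_tsum_wzTerm :
    Tendsto (fun x => ∑' k, wzTerm x k) (𝓝[>] 0) (𝓝 (∑' k, wzTerm 0 k)) := by
  refine tendsto_tsum_of_dominated_convergence
    ((summable_wzTerm zero_le_one).mul_left ((6 * 1 + 1) * (6 * 1 + 3)))
    (fun k => (continuousAt_wzTerm k).tendsto.mono_left nhdsWithin_le_nhds) ?_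
  filter_upwards [Ioc_mem_nhdsGT (zero_lt_one (α := ℝ))] with x hx k
  have h := wzTerm_ratio_mono hx.1.le hx.2 k
  have hp := wzTerm_pos hx.1.le k
  rw [Real.norm_of_nonneg hp.le]
  refine le_trans ?_ h
  refine le_mul_of_one_le_left hp.le ?_
  nlinarith [hx.1]

theorem wzStep_sub_div {x : ℝ} (hx : 0 < x) (n : ℕ) :
    (wzStep n - wzStep (x + n)) / x = 288 * (2 * n + 1 + x) /
      ((6 * n + 1) * (6 * n + 5) * ((6 * (x + n) + 1) * (6 * (x + n) + 5))) := by
  simp only [wzStep]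
  have : 0 < x + n := by positivity
  field_simp
  ring

theorem tendsto_tsum_wzStep :
    Tendsto (fun x : ℝ => ∑' n : ℕ, (wzStep n - wzStep (x + n)) / x) (𝓝[>] 0)
      (𝓝 (∑' n : ℕ, (12 / (6 * (n : ℝ) + 1) ^ 2 - 12 / (6 * (n : ℝ) + 5) ^ 2))) := by
  refine tendsto_tsum_of_dominated_convergence (summable_inv_add_one_sq.mul_left 576)
    (fun n => ?_) ?_
  · have hc : ContinuousAt (fun x : ℝ => 288 * (2 * (n : ℝ) + 1 + x) /
        ((6 * n + 1) * (6 * n + 5) * ((6 * (x + n) + 1) * (6 * (x + n) + 5)))) 0 := by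
      refine ContinuousAt.div (by fun_prop) (by fun_prop) ?_
      simp only [zero_add]
      positivity
    have h := hc.tendsto.mono_left (nhdsWithin_le_nhds (s := Set.Ioi 0))
    convert h.congr' ?_ using 2
    · simp only [zero_add, add_zero]
      field_simp
      ring
    · filter_upwards [self_mem_nhdsWithin] with x hx
      exact (wzStep_sub_div hx n).symm
  · filter_upwards [Ioc_mem_nhdsGT (zero_lt_one (α := ℝ))] with x hx n
    have hn : (0:ℝ) ≤ n := n.cast_nonneg
    have hx0 := hx.1
    rw [wzStep_sub_div hx.1, Real.norm_of_nonneg (by positivity), mul_one_div]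
    calc _ ≤ 288 * (2 * n + 1 + 1) / ((n + 1) * 1 * ((n + 1) * (n + 1)) : ℝ) := by
          have hx1 := hx.2
          gcongr <;> linarith
      _ = _ := by field_simp; ring

theorem tsum_wzTerm_zero :
    ∑' k, wzTerm 0 k =
      ∑' n : ℕ, (12 / (6 * (n : ℝ) + 1) ^ 2 - 12 / (6 * (n : ℝ) + 5) ^ 2) := by
  refine tendsto_nhds_unique tendsto_tsum_wzTerm (tendsto_tsum_wzStep.congr' ?_)
  filter_upwards [Ioc_mem_nhdsGT (zero_lt_one (α := ℝ))] with x hx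
  exact (tsum_wzTerm_eq hx.1 hx.2).symm

/-! ### The Kronecker symbol of `-3` and the `L`-value -/

theorem jacobiSym_neg_three_of_odd {m : ℕ} (hm : Odd m) :
    jacobiSym (-3) m = if m % 3 = 1 then 1 else if m % 3 = 2 then -1 else 0 := by
  rw [jacobiSym.mod_right (-3) hm]
  -- the symbol depends on `m` modulo `12` only, which leaves six odd residues
  have h3 : m % 3 = m % 12 % 3 := by omega
  have ho : m % 12 % 2 = 1 := by have := Nat.odd_iff.1 hm; omega
  have hlt : m % 12 < 12 := Nat.mod_lt _ (by norm_num)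
  rw [h3, show 4 * (-3 : ℤ).natAbs = 12 by rfl]
  generalize m % 12 = r at *
  interval_cases r <;> simp at ho ⊢ <;> norm_num

theorem kroneckerSym_neg_three {n : ℕ} (hn : n ≠ 0) :
    kroneckerSym (-3) n = if n % 3 = 1 then 1 else if n % 3 = 2 then -1 else 0 := by
  rw [kroneckerSym, if_neg hn]
  have hodd : Odd (n / 2 ^ n.factorization 2) :=
    Nat.odd_iff.2 (Nat.two_dvd_ne_zero.1 (Nat.not_dvd_ordCompl Nat.prime_two hn))
  have hmul := Nat.ordProj_mul_ordCompl_eq_self n 2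
  rw [jacobiSym_neg_three_of_odd hodd, show ZMod.χ₈ ((-3 : ℤ) : ZMod 8) = -1 by decide]
  generalize n.factorization 2 = e at *
  generalize n / 2 ^ e = m at *
  subst hmul
  clear hn hodd
  induction e with
  | zero => simp
  | succ e ih =>
    rw [pow_succ', neg_one_mul, neg_mul, ih, pow_succ', mul_assoc 2]
    generalize 2 ^ e * m = l
    split_ifs <;> first | rfl | omega

theorem LSeries_term_kroneckerSym_neg_three (n : ℕ) :
    LSeries.term (fun n : ℕ => (kroneckerSym (-3) n : ℂ)) 2 n =
      (((if n % 3 = 1 then 1 else if n % 3 = 2 then -1 else 0 : ℝ) / (n : ℝ) ^ 2 : ℝ) : ℂ) := by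
  rcases eq_or_ne n 0 with rfl | hn
  · simp
  · rw [LSeries.term_of_ne_zero hn, kroneckerSym_neg_three hn, Complex.cpow_ofNat]
    push_cast
    split_ifs <;> simp

theorem summable_chi_div_sq : Summable fun n : ℕ =>
    (if n % 3 = 1 then 1 else if n % 3 = 2 then -1 else 0 : ℝ) / (n : ℝ) ^ 2 := by
  refine (Real.summable_one_div_nat_pow.2 one_lt_two).of_norm_bounded fun n => ?_
  rw [norm_div, Real.norm_of_nonneg (by positivity : (0 : ℝ) ≤ (n : ℝ) ^ 2)]
  gcongr
  split_ifs <;> simp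

/-- Write `L` for the sum on the left. As `(-3 / 2 n) = -(-3 / n)`, its even part is `-L / 4`, so its odd
part, which is the sum over the residues `1` and `5` modulo `6`, is `5 L / 4`. -/
theorem tsum_chi_div_sq :
    15 * ∑' n : ℕ, (if n % 3 = 1 then 1 else if n % 3 = 2 then -1 else 0 : ℝ) / (n : ℝ) ^ 2 =
      ∑' n : ℕ, (12 / (6 * (n : ℝ) + 1) ^ 2 - 12 / (6 * (n : ℝ) + 5) ^ 2) := by
  set f : ℕ → ℝ := fun n =>
    (if n % 3 = 1 then 1 else if n % 3 = 2 then -1 else 0 : ℝ) / (n : ℝ) ^ 2 with hf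
  have hs : Summable f := summable_chi_div_sq
  have heven (n : ℕ) : f (2 * n) = -(1 / 4) * f n := by
    rcases eq_or_ne n 0 with rfl | hn
    · simp [hf]
    · have : (if 2 * n % 3 = 1 then 1 else if 2 * n % 3 = 2 then -1 else 0 : ℝ) =
          -(if n % 3 = 1 then 1 else if n % 3 = 2 then -1 else 0 : ℝ) := by
        split_ifs <;> first | omega | norm_num
      simp only [hf, this]
      push_cast
      field_simp
      ring
  have hso : Summable fun n => f (2 * n + 1) :=
    hs.comp_injective fun a b h => by simpa using h
  have hsplit := tsum_even_add_odd (hs.comp_injective fun a b h => by simpa using h) hso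
  simp only [heven, tsum_mul_left] at hsplit
  have hodd := Nat.sumByResidueClasses hso 3
  have e0 (m : ℕ) : f (2 * (0 + 3 * m) + 1) = 1 / (6 * (m : ℝ) + 1) ^ 2 := by
    simp only [hf]
    rw [if_pos (by omega)]
    push_cast
    ring_nf
  have e1 (m : ℕ) : f (2 * (1 + 3 * m) + 1) = 0 := by
    simp only [hf]
    rw [if_neg (by omega), if_neg (by omega), zero_div]
  have e2 (m : ℕ) : f (2 * (2 + 3 * m) + 1) = -(1 / (6 * (m : ℝ) + 5) ^ 2) := by
    simp only [hf]
    rw [if_neg (by omega), if_pos (by omega)]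
    push_cast
    ring_nf
  have hd (c : ℕ) : Summable fun m => f (2 * (c + 3 * m) + 1) :=
    hs.comp_injective fun a b h => by simpa using h
  have s0 := hd 0
  have s2 := hd 2
  simp only [e0] at s0
  simp only [e2] at s2
  rw [show (Finset.univ : Finset (ZMod 3)) = {0, 1, 2} by rfl] at hodd
  rw [Finset.sum_insert (by decide), Finset.sum_insert (by decide), Finset.sum_singleton,
    show (0 : ZMod 3).val = 0 by rfl, show (1 : ZMod 3).val = 1 by rfl,
    show (2 : ZMod 3).val = 2 by rfl] at hodd
  simp only [e0, e1, e2, tsum_zero] at hodd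
  rw [zero_add] at hodd
  rw [← s0.tsum_add s2] at hodd
  calc 15 * ∑' n, f n = 12 * (5 / 4 * ∑' n, f n) := by ring
    _ = 12 * ∑' n, f (2 * n + 1) := by congr 1; linarith
    _ = _ := by
      rw [hodd, ← tsum_mul_left]
      exact tsum_congr fun n => by ring

/-! ### The evaluation -/

theorem wzTerm_zero_eq (k : ℕ) :
    wzTerm 0 k = 2 * (48 ^ (k + 1) / (((k + 1 : ℕ) : ℝ) * (2 * ((k + 1 : ℕ) : ℝ) - 1) *
      (Nat.choose (4 * (k + 1)) (2 * (k + 1)) : ℝ) * (Nat.choose (2 * (k + 1)) (k + 1) : ℝ))) := by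
  have h4 (m : ℕ) : Nat.choose (4 * m) (2 * m) = Nat.centralBinom (2 * m) := by
    rw [Nat.centralBinom, ← mul_assoc]; norm_num
  simp only [h4, ← Nat.centralBinom_eq_two_mul_choose]
  have hsucc (m : ℕ) : (Nat.centralBinom (m + 1) : ℝ) =
      2 * (2 * m + 1) / (m + 1) * Nat.centralBinom m := by
    have := Nat.succ_mul_centralBinom_succ m
    rify at this
    field_simp
    linarith
  induction k with
  | zero => norm_num [wzTerm, Nat.centralBinom, Nat.choose]
  | succ k ih =>
    have h1 := Nat.centralBinom_pos (k + 1)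
    have h2 := Nat.centralBinom_pos (2 * (k + 1))
    rw [wzTerm, ih, show 2 * (k + 1 + 1) = 2 * (k + 1) + 1 + 1 by ring, hsucc (k + 1),
      hsucc (2 * (k + 1) + 1), hsucc (2 * (k + 1))]
    push_cast
    rw [show (2 * ((k : ℝ) + 1) - 1) = 2 * k + 1 by ring,
      show (2 * ((k : ℝ) + 1 + 1) - 1) = 2 * k + 3 by ring]
    field_simp
    ring

theorem mainTheorem5 :
    LSeriesSummable (fun n : ℕ => (kroneckerSym (-3) n : ℂ)) 2 ∧
    Summable (fun k : ℕ+ => (48 : ℂ) ^ (k : ℕ) /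
      ((k : ℂ) * (2 * (k : ℂ) - 1) *
        (Nat.choose (4 * (k : ℕ)) (2 * (k : ℕ)) : ℂ) * (Nat.choose (2 * (k : ℕ)) (k : ℕ) : ℂ))) ∧
    kroneckerL (-3) 2 = 2 / 15 * ∑' k : ℕ+, (48 : ℂ) ^ (k : ℕ) /
      ((k : ℂ) * (2 * (k : ℂ) - 1) *
        (Nat.choose (4 * (k : ℕ)) (2 * (k : ℕ)) : ℂ) * (Nat.choose (2 * (k : ℕ)) (k : ℕ) : ℂ)) := by
  set g : ℕ → ℂ := fun k => (48 : ℂ) ^ k / ((k : ℂ) * (2 * (k : ℂ) - 1) *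
    (Nat.choose (4 * k) (2 * k) : ℂ) * (Nat.choose (2 * k) k : ℂ)) with hg
  have hterm (k : ℕ) : g (k + 1) = ((wzTerm 0 k / 2 : ℝ) : ℂ) := by
    rw [wzTerm_zero_eq, mul_div_cancel_left₀ _ two_ne_zero, hg]
    push_cast
    rfl
  refine ⟨?_, ?_, ?_⟩
  · rw [LSeriesSummable, funext LSeries_term_kroneckerSym_neg_three]
    exact Complex.ofRealCLM.summable summable_chi_div_sq
  · refine (summable_pnat_iff_summable_succ (f := g)).2 ?_
    simp only [hterm]
    exact Complex.ofRealCLM.summable ((summable_wzTerm le_rfl).div_const 2)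
  · have hright : ∑' k : ℕ+, g k = ((∑' k, wzTerm 0 k / 2 : ℝ) : ℂ) := by
      rw [tsum_pnat_eq_tsum_succ (f := g), Complex.ofReal_tsum]
      exact tsum_congr hterm
    have hleft := tsum_chi_div_sq
    rw [← tsum_wzTerm_zero] at hleft
    change _ = 2 / 15 * ∑' k : ℕ+, g k
    rw [hright, kroneckerL, LSeries, tsum_congr LSeries_term_kroneckerSym_neg_three,
      ← Complex.ofReal_tsum, tsum_div_const, ← hleft]
    push_cast
    ring
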